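/- An occurrence of a pattern $q\in S_k$ in a permutation $p=p_1\cdots p_n$ is a choice of positions $i_1<\dots<i_k$ such that $p_{i_1},\dots,p_{i_k}$ are in the same relative order as $q_1,\dots,q_k$; $p$ avoids $q$ if there is no such occurrence. A permutation $p$ of length $n$ is (skew-)decomposable if there is $k$ with $1\le k\le n-1$ such that $p_i>p_j$ for all $i\le k<j$, and indecomposable otherwise. Let $\mathrm{Av}_n^*(123)$ be the set of indecomposable $123$-avoiding permutations of length $n$, and let $a_n^*$ be the total number of occurrences of $213$ in all permutations in $\mathrm{Av}_n^*(123)$. Let $C(x)=\sum_{n\ge 0}\frac{1}{n+1}\binom{2n}{n}x^n$. Then, as formal power series, $$\sum_{n\ge 0}a_n^*x^n=\frac{x^3C(x)}{(1-4x)^{3/2}}=\frac{x^2}{2(1-4x)^{3/2}}-\frac{x^2}{2(1-4x)}.$$ Moreover, $a_{m+2}^*=\frac{2m+1}{2}\binom{2m}{m}-\frac{4^m}{2}$ for all $m\ge 0$ (the sequence $0,1,7,38,187,874,\dots$, OEIS A000531). -/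

import Mathlib

namespace PatternCount

/-- `occurrences q p` is the set of occurrences of the pattern `q` in the permutation `p`
(`p i` is the entry in position `i`): strictly increasing choices `e` of positions of `p` at which
the entries of `p` are in the same relative order as the entries of `q`. -/
def occurrences {k n : ℕ} (q : Equiv.Perm (Fin k)) (p : Equiv.Perm (Fin n)) :
    Finset (Fin k → Fin n) :=
  Finset.univ.filter fun e =>
    (∀ i j, i < j → e i < e j) ∧ ∀ i j, p (e i) < p (e j) ↔ q i < q j

/-- The number of occurrences of `q` in `p` as a pattern. -/
def num {k n : ℕ} (q : Equiv.Perm (Fin k)) (p : Equiv.Perm (Fin n)) : ℕ :=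
  (occurrences q p).card

/-- The total number of occurrences of `q` in the permutations of a finite set `S`. -/
def totalNum {k n : ℕ} (q : Equiv.Perm (Fin k)) (S : Finset (Equiv.Perm (Fin n))) : ℕ :=
  ∑ p ∈ S, num q p

/-- The pattern `123`. -/
def pat123 : Equiv.Perm (Fin 3) := 1

/-- The pattern `213`, with one-line notation `1, 0, 2` on `Fin 3 = {0, 1, 2}`. -/
def pat213 : Equiv.Perm (Fin 3) := Equiv.swap 0 1

/-- The permutation `p` avoids the pattern `q`. -/
abbrev Avoids {k n : ℕ} (q : Equiv.Perm (Fin k)) (p : Equiv.Perm (Fin n)) : Prop :=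
  occurrences q p = ∅

/-- `p` is (skew-)decomposable: for some `0 < k < n`, each of the first `k` entries is larger than
each of the remaining `n - k` entries. -/
abbrev Decomposable {n : ℕ} (p : Equiv.Perm (Fin n)) : Prop :=
  ∃ k < n, 0 < k ∧ ∀ i j : Fin n, (i : ℕ) < k → k ≤ (j : ℕ) → p j < p i

/-- The indecomposable permutations of length `n` that avoid `123`. -/
def indecAv123 (n : ℕ) : Finset (Equiv.Perm (Fin n)) :=
  Finset.univ.filter fun p => Avoids pat123 p ∧ ¬ Decomposable p

/-- The generating function, by length, of the total number of `213` patterns in the indecomposable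
`123`-avoiding permutations. -/
noncomputable def genFun213 : PowerSeries ℚ :=
  PowerSeries.mk fun n => (totalNum pat213 (indecAv123 n) : ℚ)

/-- The generating function of the Catalan numbers, with rational coefficients. -/
noncomputable def catalanGF : PowerSeries ℚ :=
  PowerSeries.map (Nat.castRingHom ℚ) PowerSeries.catalanSeries

/-- The formal power series `(1 - 4 X) ^ a = ∑ n, choose a n * (-4 X) ^ n`. -/
noncomputable def oneSubFourXPow (a : ℚ) : PowerSeries ℚ :=
  PowerSeries.rescale (-4 : ℚ) (PowerSeries.binomialSeries ℚ a)

end PatternCount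

namespace PatternCount

open Finset

/-! Permutations are grown by appending last entries. For a `123`-avoider two statistics suffice:
the ceiling s, which is the largest value that can be appended, and the cut length m, which vanishes
exactly for indecomposables. Appending 0 turns (s, m) into (s + 1, m + 1). Appending v with 0 < v ≤
s makes the ceiling v, and the cut length m + 1 if v ≤ m, otherwise 0. Appending v creates v choose
2 new occurrences of `213`, since the v smaller entries before it must be decreasing.

So the future of a permutation depends only on (m, s). The series for its indecomposable
completions, and for the patterns they create, satisfy linear recursions with a factor X on the
right, which determine them coefficientwise. The explicit solutions are verified algebraically:
powers of C(x) for completions (`completionSeries_eq`), and C(x)^j times a cubic in j for patterns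
(`completionPatternSeries_eq`). `totalNum_indecAv123_add` ties them to permutations. Starting from
length 1, with (m, s) = (0, 1), the answer is X * `patternSeries 1`, and 1 - 2xC(x) = √(1 - 4x)
gives the closed forms. -/

/-- Append a last entry of value `v` to `q`, raising by one the entries that are at least `v`. -/
def snocPerm {n : ℕ} (v : Fin (n + 1)) (q : Equiv.Perm (Fin n)) : Equiv.Perm (Fin (n + 1)) :=
  (finSuccEquiv' (Fin.last n)).trans ((Equiv.optionCongr q).trans (finSuccEquiv' v).symm)

@[simp]
theorem snocPerm_castSucc {n : ℕ} (v : Fin (n + 1)) (q : Equiv.Perm (Fin n)) (i : Fin n) :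
    snocPerm v q i.castSucc = v.succAbove (q i) := by
  rw [← Fin.succAbove_last]
  simp [snocPerm, -Fin.succAbove_last]

@[simp]
theorem snocPerm_last {n : ℕ} (v : Fin (n + 1)) (q : Equiv.Perm (Fin n)) :
    snocPerm v q (Fin.last n) = v := by
  simp [snocPerm]

theorem snocPerm_bijective (n : ℕ) :
    Function.Bijective fun x : Fin (n + 1) × Equiv.Perm (Fin n) => snocPerm x.1 x.2 := by
  rw [Fintype.bijective_iff_injective_and_card]
  refine ⟨?_, by simp [Fintype.card_perm, Nat.factorial_succ]⟩
  rintro ⟨v, q⟩ ⟨w, r⟩ h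
  have hv : v = w := by simpa using congrArg (fun e => e (Fin.last n)) h
  subst hv
  have hq : q = r := by
    ext1 i
    simpa using congrArg (fun e => e i.castSucc) h
  rw [hq]

theorem val_succAbove {n : ℕ} (v : Fin (n + 1)) (x : Fin n) :
    (v.succAbove x : ℕ) = if (x : ℕ) < v then (x : ℕ) else x + 1 := by
  by_cases h : x.castSucc < v
  · rw [Fin.succAbove_of_castSucc_lt _ _ h, if_pos (by simpa [Fin.lt_def] using h)]
    simp
  · rw [Fin.succAbove_of_le_castSucc _ _ (not_lt.mp h),
      if_neg (by simpa [Fin.lt_def] using h)]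
    simp

/-! ### Avoidance of `123` and occurrences of `213` -/

theorem avoids_pat123_iff {n : ℕ} (p : Equiv.Perm (Fin n)) :
    Avoids pat123 p ↔ ∀ i j k, i < j → j < k → p i < p j → ¬ p j < p k := by
  unfold Avoids occurrences
  rw [filter_eq_empty_iff]
  constructor
  · intro h i j k hij hjk h1 h2
    refine h (mem_univ ![i, j, k]) ⟨?_, ?_⟩
    · intro a b hab
      fin_cases a <;> fin_cases b <;> simp_all <;> exact hij.trans hjk
    · intro a b
      have := h1.trans h2
      fin_cases a <;> fin_cases b <;> simp [pat123, *, le_of_lt]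
  · rintro h e - ⟨h1, h2⟩
    exact h (e 0) (e 1) (e 2) (h1 _ _ (by decide)) (h1 _ _ (by decide))
      ((h2 _ _).2 (by simp [pat123])) ((h2 _ _).2 (by simp [pat123]))

/-- The positions of the smaller entries to the left of position `k`. -/
def smallerBefore {n : ℕ} (p : Equiv.Perm (Fin n)) (k : Fin n) : Finset (Fin n) :=
  univ.filter fun i => i < k ∧ p i < p k

theorem card_filter_lt_product {α : Type*} [LinearOrder α] (s : Finset α) :
    ((s ×ˢ s).filter fun x => x.1 < x.2).card = s.card.choose 2 := by
  induction s using Finset.induction_on_max with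
  | empty => simp
  | insert a s ha ih =>
    have ha' : a ∉ s := fun h => lt_irrefl _ (ha a h)
    rw [card_insert_of_notMem ha', Nat.choose_succ_succ' _ 1, Nat.choose_one_right, ← ih,
      ← card_image_of_injective s (Prod.mk_left_injective a), ← card_union_of_disjoint]
    · congr 1
      ext ⟨x, y⟩
      simp only [mem_filter, mem_product, mem_insert, mem_union, mem_image, Prod.mk.injEq]
      constructor
      · rintro ⟨⟨rfl | hx, rfl | hy⟩, h⟩
        · exact (lt_irrefl _ h).elim
        · exact (lt_asymm h (ha _ hy)).elim
        · exact Or.inl ⟨x, hx, rfl, rfl⟩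
        · exact Or.inr ⟨⟨hx, hy⟩, h⟩
      · rintro (⟨b, hb, rfl, rfl⟩ | ⟨⟨hx, hy⟩, h⟩)
        · exact ⟨⟨Or.inr hb, Or.inl rfl⟩, ha _ hb⟩
        · exact ⟨⟨Or.inr hx, Or.inr hy⟩, h⟩
    · rw [disjoint_left]
      rintro ⟨x, y⟩ h1 h2
      simp only [mem_filter, mem_product, mem_image, Prod.mk.injEq] at h1 h2
      obtain ⟨b, -, -, rfl⟩ := h1
      exact ha' h2.1.2

/-- In a `123`-avoiding permutation, any two smaller entries to the left of an entry form
an occurrence of `213` with it. -/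
theorem num_pat213_eq {n : ℕ} {p : Equiv.Perm (Fin n)} (hp : Avoids pat123 p) :
    num pat213 p = ∑ k, (smallerBefore p k).card.choose 2 := by
  rw [avoids_pat123_iff] at hp
  simp_rw [← card_filter_lt_product]
  rw [← card_sigma]
  unfold num
  refine card_bij' (fun e _ => ⟨e 2, (e 0, e 1)⟩) (fun x _ => ![x.2.1, x.2.2, x.1]) ?_ ?_ ?_ ?_
  · intro e he
    simp only [occurrences, mem_filter, mem_univ, true_and] at he
    obtain ⟨h1, h2⟩ := he
    simp only [mem_sigma, mem_univ, true_and, mem_filter, mem_product, smallerBefore]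
    exact ⟨⟨⟨h1 _ _ (by decide), (h2 _ _).2 (by decide)⟩,
      ⟨h1 _ _ (by decide), (h2 _ _).2 (by decide)⟩⟩, h1 _ _ (by decide)⟩
  · rintro ⟨k, i, j⟩ hx
    simp only [mem_sigma, mem_univ, true_and, mem_filter, mem_product, smallerBefore] at hx
    obtain ⟨⟨⟨hik, pik⟩, hjk, pjk⟩, hij⟩ := hx
    have pji : p j < p i := by
      rcases lt_trichotomy (p j) (p i) with h | h | h
      · exact h
      · exact absurd (p.injective h) hij.ne'
      · exact absurd pjk (hp i j k hij hjk h)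
    simp only [occurrences, mem_filter, mem_univ, true_and]
    constructor
    · intro a b hab
      fin_cases a <;> fin_cases b <;> simp_all
    · intro a b
      have h0 : pat213 0 = 1 := by decide
      have h1 : pat213 1 = 0 := by decide
      have h2 : pat213 2 = 2 := by decide
      fin_cases a <;> fin_cases b <;> simp [h0, h1, h2, pik, pjk, pji, le_of_lt]
  · intro e _
    ext a
    fin_cases a <;> rfl
  · rintro ⟨k, i, j⟩ _
    rfl

theorem snocPerm_castSucc_lt_castSucc {n : ℕ} (v : Fin (n + 1)) (q : Equiv.Perm (Fin n))
    (i j : Fin n) : snocPerm v q i.castSucc < snocPerm v q j.castSucc ↔ q i < q j := by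
  simp

theorem snocPerm_castSucc_lt_last {n : ℕ} (v : Fin (n + 1)) (q : Equiv.Perm (Fin n))
    (i : Fin n) : snocPerm v q i.castSucc < snocPerm v q (Fin.last n) ↔ (q i : ℕ) < v := by
  rw [snocPerm_castSucc, snocPerm_last, Fin.succAbove_lt_iff_castSucc_lt]
  rfl

theorem card_smallerBefore_snocPerm_castSucc {n : ℕ} (v : Fin (n + 1)) (q : Equiv.Perm (Fin n))
    (k : Fin n) :
    (smallerBefore (snocPerm v q) k.castSucc).card = (smallerBefore q k).card := by
  rw [← card_map (Fin.castSuccEmb (n := n))]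
  refine congrArg card (Finset.ext fun i => ?_)
  induction i using Fin.lastCases with
  | last => simp [smallerBefore, (Fin.castSucc_lt_last _).le]
  | cast i => simp [smallerBefore]

theorem card_smallerBefore_snocPerm_last {n : ℕ} (v : Fin (n + 1)) (q : Equiv.Perm (Fin n)) :
    (smallerBefore (snocPerm v q) (Fin.last n)).card = v := by
  have h : (smallerBefore (snocPerm v q) (Fin.last n)) = (Iio v).map
      (snocPerm v q).symm.toEmbedding := by
    ext i
    simp only [smallerBefore, mem_filter, mem_univ, true_and, mem_map_equiv, Equiv.symm_symm,
      mem_Iio, snocPerm_last, and_iff_right_iff_imp]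
    intro hi
    refine lt_of_le_of_ne (Fin.le_last _) ?_
    rintro rfl
    simp at hi
  rw [h, card_map, Fin.card_Iio]

/-! ### The ceiling -/

/-- The largest value that can be appended without creating the pattern `123`. -/
def ceiling {n : ℕ} (p : Equiv.Perm (Fin n)) : ℕ :=
  Nat.findGreatest (fun v => ∀ i j, i < j → p i < p j → v ≤ p j) n

theorem le_ceiling_iff {n : ℕ} (p : Equiv.Perm (Fin n)) (v : ℕ) :
    v ≤ ceiling p ↔ v ≤ n ∧ ∀ i j, i < j → p i < p j → v ≤ p j := by
  constructor
  · intro h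
    refine ⟨h.trans (Nat.findGreatest_le n), fun i j hij hp => h.trans ?_⟩
    exact Nat.findGreatest_spec (P := fun v => ∀ i j, i < j → p i < p j → v ≤ (p j : ℕ))
      (Nat.zero_le n) (fun _ _ _ _ => Nat.zero_le _) i j hij hp
  · rintro ⟨h1, h2⟩
    exact Nat.le_findGreatest h1 h2

theorem avoids_snocPerm_iff {n : ℕ} (v : Fin (n + 1)) (q : Equiv.Perm (Fin n)) :
    Avoids pat123 (snocPerm v q) ↔ Avoids pat123 q ∧ (v : ℕ) ≤ ceiling q := by
  rw [avoids_pat123_iff, avoids_pat123_iff, le_ceiling_iff]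
  constructor
  · intro h
    refine ⟨fun i j k hij hjk h1 h2 => ?_, Nat.lt_succ_iff.mp v.2, fun i j hij h1 => ?_⟩
    · exact h i.castSucc j.castSucc k.castSucc hij hjk
        ((snocPerm_castSucc_lt_castSucc ..).2 h1) ((snocPerm_castSucc_lt_castSucc ..).2 h2)
    · have := h i.castSucc j.castSucc (Fin.last n) hij (Fin.castSucc_lt_last j)
        ((snocPerm_castSucc_lt_castSucc ..).2 h1)
      rwa [snocPerm_castSucc_lt_last, not_lt] at this
  · rintro ⟨h1, -, h2⟩ i j k hij hjk
    induction j using Fin.lastCases with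
    | last => exact absurd hjk (Fin.le_last k).not_gt
    | cast j =>
      induction i using Fin.lastCases with
      | last => exact absurd hij (Fin.le_last _).not_gt
      | cast i =>
        rw [snocPerm_castSucc_lt_castSucc]
        intro hp
        induction k using Fin.lastCases with
        | last =>
          rw [snocPerm_castSucc_lt_last, not_lt]
          exact h2 i j hij hp
        | cast k =>
          rw [snocPerm_castSucc_lt_castSucc]
          exact h1 i j k hij hjk hp

theorem num_pat213_snocPerm {n : ℕ} (v : Fin (n + 1)) (q : Equiv.Perm (Fin n))
    (h : Avoids pat123 (snocPerm v q)) :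
    num pat213 (snocPerm v q) = num pat213 q + (v : ℕ).choose 2 := by
  rw [num_pat213_eq h, num_pat213_eq ((avoids_snocPerm_iff v q).1 h).1, Fin.sum_univ_castSucc]
  simp only [card_smallerBefore_snocPerm_castSucc, card_smallerBefore_snocPerm_last]

/-- A final 0 tops no ascent and raises every other value by one. -/
theorem ceiling_snocPerm_zero {n : ℕ} (q : Equiv.Perm (Fin n)) :
    ceiling (snocPerm 0 q) = ceiling q + 1 := by
  refine eq_of_forall_le_iff fun w => ?_
  rcases w with _ | w
  · simp
  rw [Nat.add_le_add_iff_right, le_ceiling_iff, le_ceiling_iff, Nat.add_le_add_iff_right]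
  refine and_congr_right fun _ => ⟨fun h i j hij hp => ?_, fun h i j hij hp => ?_⟩
  · simpa using h i.castSucc j.castSucc hij ((snocPerm_castSucc_lt_castSucc ..).2 hp)
  · induction i using Fin.lastCases with
    | last => exact absurd hij (Fin.le_last _).not_gt
    | cast i =>
      induction j using Fin.lastCases with
      | last => simp at hp
      | cast j => simpa using h i j hij ((snocPerm_castSucc_lt_castSucc ..).1 hp)

/-- The entry 0 of `q` precedes the new entry and lies below it, so `v` tops an ascent; older ascent
tops were already at least `v`. -/
theorem ceiling_snocPerm_of_pos {n : ℕ} (v : Fin (n + 1)) (q : Equiv.Perm (Fin n))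
    (hv : 0 < (v : ℕ)) (h : (v : ℕ) ≤ ceiling q) : ceiling (snocPerm v q) = v := by
  rw [le_ceiling_iff] at h
  refine eq_of_forall_le_iff fun w => ?_
  rw [le_ceiling_iff]
  constructor
  · rintro ⟨-, hw⟩
    have hn : 0 < n := hv.trans_le h.1
    have := hw (q.symm ⟨0, hn⟩).castSucc (Fin.last n) (Fin.castSucc_lt_last _)
      ((snocPerm_castSucc_lt_last ..).2 (by simpa using hv))
    simpa using this
  · intro hw
    refine ⟨hw.trans v.2.le, fun i j hij hp => ?_⟩
    induction i using Fin.lastCases with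
    | last => exact absurd hij (Fin.le_last _).not_gt
    | cast i =>
      induction j using Fin.lastCases with
      | last => simpa using hw
      | cast j =>
        have := h.2 i j hij ((snocPerm_castSucc_lt_castSucc ..).1 hp)
        rw [snocPerm_castSucc, val_succAbove]
        split_ifs <;> omega

/-! ### Cuts and decomposability -/

/-- The last `m` positions of `p` hold exactly the values below `m`. -/
def IsCut {n : ℕ} (p : Equiv.Perm (Fin n)) (m : ℕ) : Prop :=
  ∀ i : Fin n, (i : ℕ) + m < n → m ≤ p i

theorem isCut_zero {n : ℕ} (p : Equiv.Perm (Fin n)) : IsCut p 0 := fun _ _ => Nat.zero_le _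

/-- Counting: the first n - m positions map injectively into the n - m values at least m, hence onto
them. -/
theorem IsCut.le_apply_iff {n m : ℕ} {p : Equiv.Perm (Fin n)} (h : IsCut p m) (i : Fin n) :
    m ≤ p i ↔ (i : ℕ) + m < n := by
  refine ⟨fun hi => ?_, h i⟩
  have hm : m < n := hi.trans_lt (p i).2
  have key : (univ.filter fun i : Fin n => (i : ℕ) + m < n).map p.toEmbedding =
      univ.filter fun x : Fin n => m ≤ (x : ℕ) := by
    refine eq_of_subset_of_card_le ?_ ?_
    · intro x hx
      simp only [mem_map_equiv, mem_filter, mem_univ, true_and] at hx ⊢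
      simpa using h _ hx
    · rw [card_map]
      refine card_le_card_of_injOn Fin.rev ?_ (fun a _ b _ hab => Fin.rev_injective hab)
      intro x hx
      simp only [coe_filter, mem_univ, true_and, Set.mem_ofPred_eq, Fin.val_rev] at hx ⊢
      omega
  have : p i ∈ (univ.filter fun i : Fin n => (i : ℕ) + m < n).map p.toEmbedding := by
    rw [key]
    simpa using hi
  simpa [mem_map_equiv] using this

theorem isCut_snocPerm_succ_iff {n m : ℕ} (hm : m < n) (v : Fin (n + 1))
    (q : Equiv.Perm (Fin n)) :
    IsCut (snocPerm v q) (m + 1) ↔ IsCut q m ∧ (v : ℕ) ≤ m := by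
  constructor
  · intro h
    have hs : ∀ i : Fin n, (i : ℕ) + m < n → m + 1 ≤ v.succAbove (q i) := fun i hi => by
      simpa using h i.castSucc (by simp; omega)
    have hq : IsCut q m := fun i hi => by
      have := hs i hi
      rw [val_succAbove] at this
      split_ifs at this <;> omega
    refine ⟨hq, ?_⟩
    -- The value `m` of `q` sits before the cut, so it has to be raised, which forces `v ≤ m`.
    have hi := (hq.le_apply_iff (q.symm ⟨m, hm⟩)).1 (by simp)
    have := hs _ hi
    rw [val_succAbove] at this
    simp only [Equiv.apply_symm_apply] at this
    split_ifs at this <;> omega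
  · rintro ⟨h, hv⟩ i hi
    induction i using Fin.lastCases with
    | last => simp at hi
    | cast i =>
      have := h i (by simp at hi; omega)
      rw [snocPerm_castSucc, val_succAbove]
      split_ifs <;> omega

theorem decomposable_iff {n : ℕ} (p : Equiv.Perm (Fin n)) :
    Decomposable p ↔ ∃ m, 0 < m ∧ m < n ∧ IsCut p m := by
  constructor
  · rintro ⟨k, hkn, hk, h⟩
    refine ⟨n - k, by omega, by omega, fun i hi => ?_⟩
    -- An early entry exceeds the n - k distinct later entries, so it is at least n - k.
    have : (univ.filter fun j : Fin n => k ≤ (j : ℕ)).card ≤ (Iio (p i)).card := by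
      refine card_le_card_of_injOn p ?_ p.injective.injOn
      intro j hj
      simp only [coe_filter, mem_univ, true_and, Set.mem_ofPred_eq, coe_Iio, Set.mem_Iio] at hj ⊢
      exact h i j (by omega) hj
    rw [Fin.card_Iio] at this
    refine le_trans (le_of_eq ?_) this
    have : (univ.filter fun j : Fin n => k ≤ (j : ℕ)) = Ici ⟨k, hkn⟩ := by
      ext j
      simp [Fin.le_def]
    rw [this, Fin.card_Ici]
  · rintro ⟨m, hm, hmn, h⟩
    refine ⟨n - m, by omega, by omega, fun i j hi hj => ?_⟩
    have h1 := h i (by omega)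
    have h2 := (h.le_apply_iff j).not.2 (by omega)
    rw [Fin.lt_def]
    omega

open Classical in
/-- The largest `m < n` such that the last `m` positions hold exactly the values below `m`. -/
noncomputable def cutLength {n : ℕ} (p : Equiv.Perm (Fin n)) : ℕ :=
  Nat.findGreatest (IsCut p) (n - 1)

theorem cutLength_eq_iff {n : ℕ} (hn : 0 < n) (p : Equiv.Perm (Fin n)) (m : ℕ) :
    cutLength p = m ↔ m < n ∧ IsCut p m ∧ ∀ k, m < k → k < n → ¬ IsCut p k := by
  classical
  unfold cutLength
  rw [Nat.findGreatest_eq_iff]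
  constructor
  · rintro ⟨h1, h2, h3⟩
    refine ⟨by omega, ?_, fun k hk hkn => h3 hk (by omega)⟩
    rcases Nat.eq_zero_or_pos m with rfl | hm
    · exact isCut_zero p
    · exact h2 hm.ne'
  · rintro ⟨h1, h2, h3⟩
    exact ⟨by omega, fun _ => h2, fun k hk hkn => h3 k hk (by omega)⟩

theorem cutLength_eq_zero_iff {n : ℕ} (hn : 0 < n) (p : Equiv.Perm (Fin n)) :
    cutLength p = 0 ↔ ¬ Decomposable p := by
  rw [cutLength_eq_iff hn, decomposable_iff]
  push Not
  exact ⟨fun h => h.2.2, fun h => ⟨hn, isCut_zero p, h⟩⟩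

/-- Positive length is needed: a permutation of length 1 has cut length 0, although it extends the
empty one by `v = 0`. -/
theorem cutLength_snocPerm {n : ℕ} (hn : 0 < n) (v : Fin (n + 1)) (q : Equiv.Perm (Fin n)) :
    cutLength (snocPerm v q) = if (v : ℕ) ≤ cutLength q then cutLength q + 1 else 0 := by
  obtain ⟨h1, h2, h3⟩ := (cutLength_eq_iff hn q _).1 rfl
  rw [cutLength_eq_iff n.succ_pos]
  split_ifs with hv
  · refine ⟨by omega, (isCut_snocPerm_succ_iff h1 v q).2 ⟨h2, hv⟩, fun k hk hkn hc => ?_⟩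
    obtain ⟨k, rfl⟩ : ∃ l, k = l + 1 := ⟨k - 1, by omega⟩
    exact h3 k (by omega) (by omega) ((isCut_snocPerm_succ_iff (by omega) v q).1 hc).1
  · refine ⟨by omega, isCut_zero _, fun k hk hkn hc => ?_⟩
    obtain ⟨k, rfl⟩ : ∃ l, k = l + 1 := ⟨k - 1, by omega⟩
    have := (isCut_snocPerm_succ_iff (by omega) v q).1 hc
    exact h3 k (by omega) (by omega) this.1

/-! ### The Catalan series and powers of 1 - 4x -/

open PowerSeries

theorem catalanGF_eq : catalanGF = 1 + X * catalanGF ^ 2 := by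
  have h := congrArg (PowerSeries.map (Nat.castRingHom ℚ)) catalanSeries_sq_mul_X_add_one
  simp only [map_add, map_mul, map_pow, map_X, map_one] at h
  unfold catalanGF
  linear_combination -h

/-- The series `1 - 2 x C(x)`, a square root of `1 - 4 x`. -/
noncomputable def rootSeries : PowerSeries ℚ := 1 - 2 * X * catalanGF

theorem rootSeries_sq : rootSeries ^ 2 = 1 - 4 * X := by
  unfold rootSeries
  linear_combination (-4 * X) * catalanGF_eq

theorem constantCoeff_rootSeries : constantCoeff rootSeries = 1 := by
  simp [rootSeries]

theorem rootSeries_mul_inv : rootSeries * rootSeries⁻¹ = 1 :=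
  PowerSeries.mul_inv_cancel _ (by rw [constantCoeff_rootSeries]; exact one_ne_zero)

theorem oneSubFourXPow_add (a b : ℚ) :
    oneSubFourXPow (a + b) = oneSubFourXPow a * oneSubFourXPow b := by
  simp [oneSubFourXPow]

theorem oneSubFourXPow_one : oneSubFourXPow 1 = 1 - 4 * X := by
  have := binomialSeries_nat (R := ℚ) (A := ℚ) 1
  rw [Nat.cast_one, pow_one] at this
  rw [oneSubFourXPow, this, map_add, map_one, rescale_X]
  rw [map_neg, map_ofNat]
  ring

theorem constantCoeff_oneSubFourXPow (a : ℚ) : constantCoeff (oneSubFourXPow a) = 1 := by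
  rw [← coeff_zero_eq_constantCoeff_apply, oneSubFourXPow, coeff_rescale,
    coeff_zero_eq_constantCoeff_apply]
  simp

/-- Both series square to 1 - 4x; the constant coefficient 1 decides the sign. -/
theorem oneSubFourXPow_half : oneSubFourXPow (1 / 2) = rootSeries := by
  have h : (oneSubFourXPow (1 / 2) - rootSeries) * (oneSubFourXPow (1 / 2) + rootSeries) = 0 := by
    have := oneSubFourXPow_add (1 / 2) (1 / 2)
    rw [add_halves, oneSubFourXPow_one] at this
    linear_combination -this - rootSeries_sq
  rcases mul_eq_zero.1 h with h | h
  · exact sub_eq_zero.1 h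
  · have := congrArg constantCoeff h
    rw [map_add, constantCoeff_oneSubFourXPow, constantCoeff_rootSeries] at this
    norm_num at this

theorem oneSubFourXPow_three_halves : oneSubFourXPow (3 / 2) = rootSeries ^ 3 := by
  rw [show (3 / 2 : ℚ) = 1 / 2 + (1 / 2 + 1 / 2) by norm_num, oneSubFourXPow_add,
    oneSubFourXPow_add, oneSubFourXPow_half]
  ring

/-- Both sides start at 1 and satisfy (m + 1) a(m + 1) = (4m + 6) a(m). -/
theorem coeff_oneSubFourXPow_neg_three_halves (m : ℕ) :
    coeff m (oneSubFourXPow (-3 / 2)) = (2 * m + 1) * (Nat.choose (2 * m) m : ℚ) := by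
  rw [oneSubFourXPow, coeff_rescale, binomialSeries_coeff, smul_eq_mul, mul_one]
  have step : ∀ (r : ℚ) (k : ℕ), ((k : ℚ) + 1) * Ring.choose r (k + 1) =
      (r - k) * Ring.choose r k := by
    intro r k
    have h := Ring.choose_smul_choose r (Nat.le_succ k)
    rw [Nat.succ_eq_add_one, Nat.choose_succ_self_right, Nat.add_sub_cancel_left,
      Ring.choose_one_right, nsmul_eq_mul] at h
    push_cast at h
    linear_combination h
  change _ = (2 * (m : ℚ) + 1) * (Nat.centralBinom m : ℚ)
  induction m with
  | zero => simp
  | succ m ih =>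
    have h1 : ((m : ℚ) + 1) * (Nat.centralBinom (m + 1) : ℚ) =
        2 * (2 * m + 1) * (Nat.centralBinom m : ℚ) := by
      exact_mod_cast Nat.succ_mul_centralBinom_succ m
    have h2 := step (-3 / 2) m
    have h3 : ((m : ℚ) + 1) ≠ 0 := by positivity
    apply mul_left_cancel₀ h3
    push_cast
    rw [pow_succ]
    linear_combination (-4) * (-4) ^ m * h2 + (-4) * (-3 / 2 - (m : ℚ)) * ih -
      (2 * (m : ℚ) + 3) * h1

/-! ### Solving the pattern recursion -/

/-- Generating function, by the number of entries still to be appended, of the `213` patterns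
still to be created in the ways to complete an indecomposable `123`-avoiding permutation with
ceiling `j` to an indecomposable one. -/
noncomputable def patternSeries (j : ℕ) : PowerSeries ℚ :=
  catalanGF ^ j *
    ((C (1 / 2) * X ^ 2 * catalanGF * rootSeries⁻¹ ^ 3 - C (1 / 6) * X * rootSeries⁻¹) * (j : ℚ⟦X⟧)
      + C (1 / 2) * X ^ 2 * catalanGF * rootSeries⁻¹ ^ 2 * (j : ℚ⟦X⟧) ^ 2
      + C (1 / 6) * X * rootSeries⁻¹ * (j : ℚ⟦X⟧) ^ 3)

theorem catalanGF_pow_succ (j : ℕ) :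
    catalanGF ^ (j + 1) = catalanGF ^ j + X * catalanGF ^ (j + 2) := by
  linear_combination catalanGF ^ j * catalanGF_eq

theorem patternSeries_zero : patternSeries 0 = 0 := by
  simp [patternSeries]

theorem inv_rootSeries_eq :
    rootSeries⁻¹ - 2 * X * catalanGF * rootSeries⁻¹ = 1 := by
  have h := rootSeries_mul_inv
  nth_rewrite 1 [rootSeries] at h
  linear_combination h

theorem C_sixth_mul_six : (C (1 / 6) : ℚ⟦X⟧) * 6 = 1 := by
  rw [← map_ofNat (C (R := ℚ)) 6, ← map_mul]
  norm_num

theorem C_half_eq : (C (1 / 2) : ℚ⟦X⟧) = 3 * C (1 / 6) := by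
  rw [← map_ofNat (C (R := ℚ)) 3, ← map_mul]
  norm_num

theorem patternSeries_one :
    patternSeries 1 = X ^ 2 * catalanGF * rootSeries⁻¹ ^ 3 := by
  simp only [patternSeries, Nat.cast_one, C_half_eq]
  have hk := C_sixth_mul_six
  have hE := inv_rootSeries_eq
  have hc := catalanGF_eq
  generalize rootSeries⁻¹ = E at *
  generalize catalanGF = c at *
  generalize (C (1 / 6) : ℚ⟦X⟧) = k at *
  linear_combination X * (X * c) * (-c * (3 * k) * E ^ 2 * hE + 6 * k * E ^ 3 * hc + E ^ 3 * hk)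

/-- C(x) is a root of t = 1 + x t², the characteristic equation of the recursion. The quadratic
forcing term on C(x)^(j + 1) is therefore resonant, which explains the cubic in `j`. -/
theorem patternSeries_succ (j : ℕ) :
    patternSeries (j + 1) = patternSeries j +
      X * (patternSeries (j + 2) + ((j + 1).choose 2 : ℚ⟦X⟧) * catalanGF ^ (j + 1)) := by
  have hch : 2 * ((j + 1).choose 2 : ℚ⟦X⟧) = ((j : ℚ⟦X⟧) + 1) * j := by
    have h2 : 2 * (j + 1).choose 2 = (j + 1) * j := by
      rw [Nat.choose_two_right, Nat.add_sub_cancel]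
      exact Nat.mul_div_cancel' (by rw [mul_comm]; exact (Nat.even_mul_succ_self j).two_dvd)
    exact_mod_cast congrArg (Nat.cast (R := ℚ⟦X⟧)) h2
  simp only [patternSeries, C_half_eq]
  have hk := C_sixth_mul_six
  have hE := inv_rootSeries_eq
  have hc := catalanGF_eq
  push_cast
  generalize rootSeries⁻¹ = E at *
  generalize catalanGF = c at *
  generalize (C (1 / 6) : ℚ⟦X⟧) = k at *
  generalize ((j + 1).choose 2 : ℚ⟦X⟧) = b at *
  generalize (j : ℚ⟦X⟧) = i at *
  linear_combination c ^ j * (c * (((3 * k * X ^ 2 * c * E ^ 2) + 6 * (i + 1) * k * X * (X * c) * E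
    + 3 * (i + 1) ^ 2 * k * X - 3 * k * X * (i + 1)) * hE + X * b * hk - 3 * k * X * hch)
    + ((3 * k * X ^ 2 * c * E ^ 3 - k * X * E) * i + 3 * k * X ^ 2 * c * E ^ 2 * i ^ 2
      + k * X * E * i ^ 3) * hc)

/-! ### Completions to an indecomposable permutation -/

/-- Generating function, by the number of entries still to be appended, of the completions of a
`123`-avoiding permutation with cut length `m` and ceiling `s` to an indecomposable one. -/
noncomputable def completionSeries (m s : ℕ) : ℚ⟦X⟧ :=
  catalanGF ^ max s m - catalanGF ^ m + if m = 0 then 1 else 0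

/-- Generating function, by the number of entries still to be appended, of the `213` patterns
created while completing a `123`-avoiding permutation with cut length `m` and ceiling `s` to an
indecomposable one. -/
noncomputable def completionPatternSeries (m s : ℕ) : ℚ⟦X⟧ :=
  patternSeries (max s m) - patternSeries m

/-- The cut length after appending `v` to a permutation with cut length `m`. -/
def nextCut (m v : ℕ) : ℕ := if v ≤ m then m + 1 else 0

/-- Once the ceiling is at most a positive cut length, this persists under every admissible append,
so no completion exists. -/
theorem completionSeries_nextCut (m v : ℕ) :
    completionSeries (nextCut m v) v = if v ≤ m then 0 else catalanGF ^ v := by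
  unfold nextCut completionSeries
  by_cases h : v ≤ m
  · simp [h, max_eq_right (show v ≤ m + 1 by omega)]
  · simp [h]

theorem completionPatternSeries_nextCut (m v : ℕ) :
    completionPatternSeries (nextCut m v) v = if v ≤ m then 0 else patternSeries v := by
  unfold nextCut completionPatternSeries
  split_ifs with h
  · rw [max_eq_right (by omega), sub_self]
  · simp [patternSeries_zero]

/-- The indicator stands for stopping now, the next term for appending 0, the sum for appending 1,
…, s. Differencing in `s` leaves `catalanGF_pow_succ`. -/
theorem completionSeries_eq (m s : ℕ) :
    completionSeries m s = (if m = 0 then 1 else 0) + X * (completionSeries (m + 1) (s + 1) +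
      ∑ v ∈ range s, completionSeries (nextCut m (v + 1)) (v + 1)) := by
  induction s with
  | zero => simp [completionSeries]
  | succ s ih =>
    rw [sum_range_succ, completionSeries_nextCut]
    unfold completionSeries at ih ⊢
    simp only [Nat.succ_ne_zero, if_false] at ih ⊢
    by_cases h : s + 1 ≤ m
    · rw [max_eq_right (by omega), max_eq_right (by omega)] at ih ⊢
      rw [if_pos h]
      linear_combination ih
    · rw [max_eq_left (by omega), max_eq_left (by omega)] at ih ⊢
      rw [if_neg h]
      linear_combination ih + catalanGF_pow_succ s

theorem completionPatternSeries_eq (m s : ℕ) :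
    completionPatternSeries m s = X * (completionPatternSeries (m + 1) (s + 1) +
      ∑ v ∈ range s, (completionPatternSeries (nextCut m (v + 1)) (v + 1) +
        ((v + 1).choose 2 : ℚ⟦X⟧) * completionSeries (nextCut m (v + 1)) (v + 1))) := by
  induction s with
  | zero => simp [completionPatternSeries]
  | succ s ih =>
    rw [sum_range_succ, completionSeries_nextCut, completionPatternSeries_nextCut]
    unfold completionPatternSeries at ih ⊢
    by_cases h : s + 1 ≤ m
    · rw [max_eq_right (by omega), max_eq_right (by omega)] at ih ⊢
      rw [if_pos h, if_pos h]
      linear_combination ih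
    · rw [max_eq_left (by omega), max_eq_left (by omega)] at ih ⊢
      rw [if_neg h, if_neg h]
      linear_combination ih + patternSeries_succ s

/-! ### Summation over permutations -/

/-- The permutations of length `n` that avoid `123`. -/
def av123 (n : ℕ) : Finset (Equiv.Perm (Fin n)) :=
  univ.filter fun p => Avoids pat123 p

theorem sum_av123_succ {n : ℕ} (f : Equiv.Perm (Fin (n + 1)) → ℚ) (g : Equiv.Perm (Fin n) → ℕ → ℚ)
    (h : ∀ v q, Avoids pat123 (snocPerm v q) → f (snocPerm v q) = g q v) :
    ∑ p ∈ av123 (n + 1), f p = ∑ q ∈ av123 n, ∑ v ∈ range (ceiling q + 1), g q v := by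
  unfold av123
  rw [sum_filter, ← (snocPerm_bijective n).sum_comp, Fintype.sum_prod_type, sum_comm, sum_filter]
  refine sum_congr rfl fun q _ => ?_
  split_ifs with hq
  · have hc : ceiling q ≤ n := ((le_ceiling_iff q _).1 le_rfl).1
    have : (range (ceiling q + 1)) = (range (n + 1)).filter (· ≤ ceiling q) := by
      ext v
      simp only [mem_range, mem_filter]
      omega
    rw [this, sum_filter, ← Fin.sum_univ_eq_sum_range (fun v => if v ≤ ceiling q then g q v else 0)]
    refine sum_congr rfl fun v _ => ?_
    by_cases hv : (v : ℕ) ≤ ceiling q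
    · have ha := (avoids_snocPerm_iff v q).2 ⟨hq, hv⟩
      rw [if_pos ha, if_pos hv, h v q ha]
    · rw [if_neg (fun ha => hv ((avoids_snocPerm_iff v q).1 ha).2), if_neg hv]
  · exact sum_eq_zero fun v _ => if_neg fun ha => hq ((avoids_snocPerm_iff v q).1 ha).1

/-- Each `p` contributes the patterns created later, plus its own patterns once per completion.
Induction on `r` trades one remaining entry for one more appended entry. -/
theorem totalNum_indecAv123_add (r n : ℕ) (hn : 0 < n) :
    (totalNum pat213 (indecAv123 (n + r)) : ℚ) = ∑ p ∈ av123 n,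
      (coeff r (completionPatternSeries (cutLength p) (ceiling p)) +
        num pat213 p * coeff r (completionSeries (cutLength p) (ceiling p))) := by
  induction r generalizing n with
  | zero =>
    have : indecAv123 n = (av123 n).filter fun p => cutLength p = 0 := by
      ext p
      simp only [indecAv123, av123, mem_filter, mem_univ, true_and, cutLength_eq_zero_iff hn]
    rw [Nat.add_zero, this, totalNum, Nat.cast_sum, sum_filter]
    refine sum_congr rfl fun p _ => ?_
    rw [completionPatternSeries_eq, completionSeries_eq, map_add, coeff_zero_X_mul,
      coeff_zero_X_mul]
    split_ifs <;> simp
  | succ r ih =>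
    rw [show n + (r + 1) = n + 1 + r by ring, ih (n + 1) n.succ_pos,
      sum_av123_succ _ (fun q v =>
        coeff r (completionPatternSeries (nextCut (cutLength q) v)
          (if v = 0 then ceiling q + 1 else v)) +
        ((num pat213 q : ℚ) + (v.choose 2 : ℕ)) *
          coeff r (completionSeries (nextCut (cutLength q) v)
            (if v = 0 then ceiling q + 1 else v)))]
    · refine sum_congr rfl fun q _ => ?_
      rw [completionPatternSeries_eq, completionSeries_eq, map_add (coeff (r + 1)),
        coeff_succ_X_mul, coeff_succ_X_mul, sum_range_succ']
      have h0 : coeff (r + 1) (if cutLength q = 0 then 1 else 0 : ℚ⟦X⟧) = 0 := by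
        split_ifs <;> simp [coeff_one]
      have hcast : ∀ (k : ℕ) (F : ℚ⟦X⟧), coeff r ((k : ℚ⟦X⟧) * F) = k * coeff r F := by
        intro k F
        rw [← nsmul_eq_mul, map_nsmul, nsmul_eq_mul]
      rw [h0]
      simp only [map_add, map_sum, hcast, Nat.succ_ne_zero, if_false, if_true, nextCut,
        Nat.zero_le, Nat.choose_zero_succ, Nat.cast_zero, add_zero, zero_add, mul_add, mul_sum,
        add_mul, sum_add_distrib]
      ring
    · intro v q hv
      rw [num_pat213_snocPerm v q hv, cutLength_snocPerm hn, Nat.cast_add]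
      have hc : ceiling (snocPerm v q) = if (v : ℕ) = 0 then ceiling q + 1 else v := by
        split_ifs with h
        · obtain rfl : v = 0 := Fin.ext h
          exact ceiling_snocPerm_zero q
        · exact ceiling_snocPerm_of_pos v q (Nat.pos_of_ne_zero h)
            ((avoids_snocPerm_iff v q).1 hv).2
      rw [hc]
      rfl

theorem totalNum_indecAv123_succ (r : ℕ) :
    (totalNum pat213 (indecAv123 (r + 1)) : ℚ) = coeff r (patternSeries 1) := by
  have h1 : Avoids pat123 (1 : Equiv.Perm (Fin 1)) := by
    rw [avoids_pat123_iff]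
    intro i j k hij
    exact absurd (Subsingleton.elim i j) hij.ne
  have hav : av123 1 = {1} := by
    ext p
    simp only [av123, mem_filter, mem_univ, true_and, mem_singleton, Subsingleton.elim p 1]
    exact iff_true_intro h1
  have hnum : num pat213 (1 : Equiv.Perm (Fin 1)) = 0 := by
    rw [num_pat213_eq h1]
    simp [smallerBefore]
  have hcut : cutLength (1 : Equiv.Perm (Fin 1)) = 0 :=
    (cutLength_eq_iff one_pos _ _).2 ⟨one_pos, isCut_zero _, fun k hk hk' => by omega⟩
  have hceil : ceiling (1 : Equiv.Perm (Fin 1)) = 1 := by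
    refine le_antisymm ((le_ceiling_iff _ _).1 le_rfl).1 ((le_ceiling_iff _ _).2 ⟨le_rfl, ?_⟩)
    intro i j hij
    exact absurd (Subsingleton.elim i j) hij.ne
  rw [add_comm, totalNum_indecAv123_add r 1 one_pos, hav, sum_singleton, hnum, hcut, hceil]
  simp [completionPatternSeries, patternSeries_zero]

/-! ### Closed forms -/

theorem genFun213_eq : genFun213 = X ^ 3 * catalanGF * rootSeries⁻¹ ^ 3 := by
  have h : genFun213 = X * patternSeries 1 := by
    ext n
    rcases n with _ | n
    · rw [coeff_zero_X_mul, genFun213, coeff_mk, totalNum]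
      refine Nat.cast_eq_zero.2 (sum_eq_zero fun p _ => card_eq_zero.2 ?_)
      exact filter_eq_empty_iff.2 fun e _ => (e 0).elim0
    · rw [coeff_succ_X_mul, genFun213, coeff_mk, totalNum_indecAv123_succ]
  rw [h, patternSeries_one]
  ring

theorem inv_rootSeries_pow (k : ℕ) : (rootSeries ^ k)⁻¹ = rootSeries⁻¹ ^ k := by
  rw [PowerSeries.inv_eq_iff_mul_eq_one]
  · rw [← mul_pow, mul_comm, rootSeries_mul_inv, one_pow]
  · rw [map_pow, constantCoeff_rootSeries, one_pow]
    exact one_ne_zero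

theorem inv_two_mul (F : ℚ⟦X⟧) : (2 * F)⁻¹ = C (1 / 2) * F⁻¹ := by
  rw [PowerSeries.mul_inv_rev, mul_comm, ← map_ofNat (C (R := ℚ)) 2, C_inv]
  norm_num

/-- With R = 1 - 2xC(x), replace xC(x) by (1 - R)/2 in x³C(x)/R³. -/
theorem genFun213_eq_sub :
    genFun213 = X ^ 2 * (2 * oneSubFourXPow (3 / 2))⁻¹ - X ^ 2 * (2 * (1 - 4 * X))⁻¹ := by
  rw [inv_two_mul, inv_two_mul, ← rootSeries_sq, oneSubFourXPow_three_halves, inv_rootSeries_pow,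
    inv_rootSeries_pow, genFun213_eq, C_half_eq]
  linear_combination (-3 * C (1 / 6) * X ^ 2 * rootSeries⁻¹ ^ 2) * inv_rootSeries_eq -
    X ^ 3 * catalanGF * rootSeries⁻¹ ^ 3 * C_sixth_mul_six

theorem inv_oneSubFourXPow_three_halves :
    (oneSubFourXPow (3 / 2))⁻¹ = oneSubFourXPow (-3 / 2) := by
  rw [PowerSeries.inv_eq_iff_mul_eq_one (by rw [constantCoeff_oneSubFourXPow]; exact one_ne_zero),
    ← oneSubFourXPow_add, oneSubFourXPow]
  norm_num

theorem coeff_inv_one_sub_four_X (m : ℕ) : coeff m ((1 - 4 * X : ℚ⟦X⟧)⁻¹) = 4 ^ m := by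
  have h : (1 - 4 * X : ℚ⟦X⟧)⁻¹ = PowerSeries.mk fun m => (4 : ℚ) ^ m := by
    rw [PowerSeries.inv_eq_iff_mul_eq_one (by simp)]
    ext n
    rw [← map_ofNat (C (R := ℚ)) 4, mul_sub, mul_one, mul_left_comm, map_sub, coeff_C_mul]
    rcases n with _ | n
    · simp
    · simp [coeff_succ_mul_X, coeff_one, pow_succ']
  rw [h, coeff_mk]

end PatternCount

open PatternCount in
theorem mainTheorem2 :
    PatternCount.genFun213 =
        PowerSeries.X ^ 3 * PatternCount.catalanGF * (PatternCount.oneSubFourXPow (3 / 2))⁻¹ ∧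
    PatternCount.genFun213 =
        PowerSeries.X ^ 2 * (2 * PatternCount.oneSubFourXPow (3 / 2))⁻¹ -
          PowerSeries.X ^ 2 * (2 * (1 - 4 * PowerSeries.X))⁻¹ ∧
    ∀ m : ℕ, (PatternCount.totalNum PatternCount.pat213 (PatternCount.indecAv123 (m + 2)) : ℚ) =
        (2 * (m : ℚ) + 1) / 2 * (Nat.choose (2 * m) m : ℚ) - 4 ^ m / 2 := by
  refine ⟨?_, genFun213_eq_sub, fun m => ?_⟩
  · rw [oneSubFourXPow_three_halves, inv_rootSeries_pow, genFun213_eq]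
  · have h := congrArg (PowerSeries.coeff (m + 2)) genFun213_eq_sub
    rw [genFun213, PowerSeries.coeff_mk, inv_two_mul, inv_two_mul, map_sub,
      PowerSeries.coeff_X_pow_mul, PowerSeries.coeff_X_pow_mul, PowerSeries.coeff_C_mul,
      PowerSeries.coeff_C_mul, inv_oneSubFourXPow_three_halves,
      coeff_oneSubFourXPow_neg_three_halves, coeff_inv_one_sub_four_X] at h
    rw [h]
    ring
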